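/- Let $q\ge 2$ be an integer, let $J$ be a real symmetric $q\times q$ matrix and $h\in\mathbb R^q$ (both fixed, not depending on $n$), and let $(A_n)_{n\ge1}$ be a sequence of real symmetric $n\times n$ matrices. Write $[q]=\{1,\dots,q\}$ and $[n]=\{1,\dots,n\}$. For $y\in[q]^n$ put $$H_n^{J,h}(y)=\frac12\sum_{i,j=1}^nA_n(i,j)\sum_{r,s=1}^qJ_{rs}\,\delta(y_i,r)\,\delta(y_j,s)+\sum_{i=1}^n\sum_{r=1}^qh_r\,\delta(y_i,r),$$ where $\delta(a,b)=1$ if $a=b$ and $\delta(a,b)=0$ otherwise. Let $Z_n(J,h)=\sum_{y\in[q]^n}e^{H_n^{J,h}(y)}$ be the partition function of the generalized $q$-state Potts measure $y\mapsto e^{H_n^{J,h}(y)}/Z_n(J,h)$ on $[q]^n$, and let $\Phi_n(J,h)=\log Z_n(J,h)$. Let $\mathcal P([q])$ be the set of probability vectors on $[q]$, and for $\mathfrak q=(\mathfrak q_1,\dots,\mathfrak q_n)\in\mathcal P([q])^n$ (identified with the product measure $\prod_{i}\mathfrak q_i$ on $[q]^n$) put $$M_n^{J,h}(\mathfrak q)=\frac12\sum_{i,j=1}^nA_n(i,j)\sum_{r,s=1}^q\mathfrak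 q_i(r)\,\mathfrak q_j(s)\,J_{rs}+\sum_{i=1}^n\sum_{r=1}^qh_r\,\mathfrak q_i(r)-\sum_{i=1}^n\sum_{r=1}^q\mathfrak q_i(r)\log\mathfrak q_i(r),$$ with the convention $0\log0=0$. Assume that, as $n\to\infty$, $$\sup_{x\in[0,1]^n}\sum_{i\in[n]}\Big|\sum_{j\in[n]}A_n(i,j)\,x_j\Big|=O(n)\qquad\text{and}\qquad \operatorname{tr}(A_n^2)=o(n).$$ Then $$\lim_{n\to\infty}\frac1n\Big[\Phi_n(J,h)-\sup_{\mathfrak q\in\mathcal P([q])^n}M_n^{J,h}(\mathfrak q)\Big]=0 .$$ -/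

import Mathlib

open Filter Topology Asymptotics

namespace MeanFieldPotts

noncomputable section

/-- The Hamiltonian `H_n^{J,h}` on `[q]^n` of the generalized `q`-state Potts model with interaction
matrix `A`; colours are indexed by `Fin q` and sites by `Fin n`. -/
def hamiltonian {n q : ℕ} (A : Matrix (Fin n) (Fin n) ℝ) (J : Matrix (Fin q) (Fin q) ℝ)
    (h : Fin q → ℝ) (y : Fin n → Fin q) : ℝ :=
  (1 / 2 : ℝ) * (∑ i, ∑ j, A i j * ∑ r, ∑ s, J r s *
      (if y i = r then (1 : ℝ) else 0) * (if y j = s then (1 : ℝ) else 0))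
    + ∑ i, ∑ r, h r * (if y i = r then (1 : ℝ) else 0)

/-- The partition function `Z_n(J,h) = ∑_y exp (H_n^{J,h}(y))`, the normalizing constant of the
generalized Potts measure. -/
def partitionFunction {n q : ℕ} (A : Matrix (Fin n) (Fin n) ℝ) (J : Matrix (Fin q) (Fin q) ℝ)
    (h : Fin q → ℝ) : ℝ :=
  ∑ y : Fin n → Fin q, Real.exp (hamiltonian A J h y)

/-- The log partition function `Φ_n(J,h) = log Z_n(J,h)`. -/
def logPartition {n q : ℕ} (A : Matrix (Fin n) (Fin n) ℝ) (J : Matrix (Fin q) (Fin q) ℝ)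
    (h : Fin q → ℝ) : ℝ :=
  Real.log (partitionFunction A J h)

/-- The mean-field functional `M_n^{J,h}` of a product measure `p = ∏ i, p i` on `[q]^n`, where each
`p i` is a probability vector on the colours. As usual, `0 * log 0 = 0`. -/
def meanFieldFunctional {n q : ℕ} (A : Matrix (Fin n) (Fin n) ℝ) (J : Matrix (Fin q) (Fin q) ℝ)
    (h : Fin q → ℝ) (p : Fin n → stdSimplex ℝ (Fin q)) : ℝ :=
  (1 / 2 : ℝ) * (∑ i, ∑ j, A i j * ∑ r, ∑ s, (p i).1 r * (p j).1 s * J r s)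
    + (∑ i, ∑ r, h r * (p i).1 r)
    - ∑ i, ∑ r, (p i).1 r * Real.log ((p i).1 r)

/-- `sup_{x ∈ [0,1]^n} ∑ i, |∑ j, A i j * x j|`; this is a supremum of a continuous function on a
nonempty compact set. -/
def cubeNorm {n : ℕ} (A : Matrix (Fin n) (Fin n) ℝ) : ℝ :=
  ⨆ x : Set.Icc (0 : Fin n → ℝ) 1, ∑ i, |∑ j, A i j * x.1 j|

/-- The mean-field assumption on a sequence of matrices: each `A n` is a symmetric `n × n` matrix,
`sup_{x ∈ [0,1]^n} ∑ i, |∑ j, A_n(i,j) x_j| = O(n)`, and `tr (A_n^2) = o(n)`. -/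
structure MeanFieldAssumption (A : (n : ℕ) → Matrix (Fin n) (Fin n) ℝ) : Prop where
  symm : ∀ n, (A n).IsSymm
  cubeNorm_isBigO : (fun n : ℕ => cubeNorm (A n)) =O[atTop] (fun n : ℕ => (n : ℝ))
  trace_isLittleO : (fun n : ℕ => (A n ^ 2).trace) =o[atTop] (fun n : ℕ => (n : ℝ))

end

end MeanFieldPotts

namespace MeanFieldPotts

open Finset Real

noncomputable section

variable {n q : ℕ}

/-! By the Gibbs variational principle, `logPartition` is the maximum of `freeEnergy` over all
probability weights `μ`. Relative to the mean-field value at its marginals, `freeEnergy` differs by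
a covariance energy minus a nonnegative entropy gap (`freeEnergy_hamiltonian_eq`). A weighted
Cauchy–Schwarz bound controls the covariance energy by `tr (A²)` and `covSq μ`, so it is small when
`covSq μ ≤ κ n`. For product weights this holds with `κ = q²` and the entropy gap vanishes, which
gives the lower bound on `logPartition`. For the upper bound, if `covSq μ > κ n`, some site has
squared covariances summing to more than `κ`. Conditioning on its colour costs at most `log q` of
entropy and lowers the expected total variance by more than `κ`. As that variance starts at most
`n`, the total cost is at most `(log q / κ) n` (`freeEnergy_le_add_totalVar`). Large `κ`, then
suitable `t`, then large `n` make every error small against `n`. -/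

/-- The one-site marginal `μ(y i = r)` of a weight `μ` on configurations. -/
def marg (μ : (Fin n → Fin q) → ℝ) (i : Fin n) (r : Fin q) : ℝ :=
  ∑ y, μ y * (if y i = r then (1 : ℝ) else 0)

/-- The two-site marginal `μ(y i = r, y j = s)`. -/
def pairMarg (μ : (Fin n → Fin q) → ℝ) (i j : Fin n) (r s : Fin q) : ℝ :=
  ∑ y, μ y * ((if y i = r then (1 : ℝ) else 0) * (if y j = s then (1 : ℝ) else 0))

/-- The covariance of the indicators of `y i = r` and `y j = s`. -/
def cov (μ : (Fin n → Fin q) → ℝ) (i j : Fin n) (r s : Fin q) : ℝ :=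
  pairMarg μ i j r s - marg μ i r * marg μ j s

/-- The sum of all squared covariances. -/
def covSq (μ : (Fin n → Fin q) → ℝ) : ℝ :=
  ∑ i, ∑ j, ∑ r, ∑ s, cov μ i j r s ^ 2

/-- The sum of the variances of all the indicators of `y i = r`. -/
def totalVar (μ : (Fin n → Fin q) → ℝ) : ℝ :=
  ∑ i, ∑ r, (marg μ i r - marg μ i r ^ 2)

/-- The Gibbs variational functional: expected energy plus Shannon entropy. -/
def freeEnergy (H : (Fin n → Fin q) → ℝ) (μ : (Fin n → Fin q) → ℝ) : ℝ :=
  ∑ y, (μ y * H y - μ y * log (μ y))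

/-- The weight `μ` conditioned on `y j = s`; it is zero if the conditioning event is null. -/
def condAt (μ : (Fin n → Fin q) → ℝ) (j : Fin n) (s : Fin q) (y : Fin n → Fin q) : ℝ :=
  μ y * (if y j = s then (1 : ℝ) else 0) / marg μ j s

/-- The product weight with one-site marginals `p i`. -/
def prodWeight (p : Fin n → Fin q → ℝ) (y : Fin n → Fin q) : ℝ :=
  ∏ i, p i (y i)

/-! ### Gibbs' inequality and elementary facts on marginals. -/

/-- Termwise `log x ≤ x - 1` at `x = ν a / μ a`. It yields the uniform entropy bound, subadditivity
of entropy and the variational principle. -/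
theorem sum_mul_log_sub_le {α : Type*} [Fintype α] (μ ν : α → ℝ) (hμ : ∀ a, 0 ≤ μ a)
    (hν : ∀ a, 0 ≤ ν a) (hac : ∀ a, μ a ≠ 0 → ν a ≠ 0) :
    ∑ a, μ a * log (ν a) - ∑ a, μ a * log (μ a) ≤ ∑ a, ν a - ∑ a, μ a := by
  rw [← sum_sub_distrib, ← sum_sub_distrib]
  refine sum_le_sum fun a _ => ?_
  by_cases h : μ a = 0
  · simpa [h] using hν a
  · have hμ' : 0 < μ a := lt_of_le_of_ne (hμ a) (Ne.symm h)
    have hν' : 0 < ν a := lt_of_le_of_ne (hν a) (Ne.symm (hac a h))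
    have h1 := log_le_sub_one_of_pos (div_pos hν' hμ')
    rw [log_div hν'.ne' hμ'.ne'] at h1
    calc μ a * log (ν a) - μ a * log (μ a) = μ a * (log (ν a) - log (μ a)) := by ring
      _ ≤ μ a * (ν a / μ a - 1) := by gcongr
      _ = ν a - μ a := by field_simp

theorem sum_mul_apply_eq_sum_marg (μ : (Fin n → Fin q) → ℝ) (i : Fin n) (f : Fin q → ℝ) :
    ∑ y, μ y * f (y i) = ∑ r, marg μ i r * f r := by
  simp only [marg, sum_mul]
  rw [sum_comm]
  refine sum_congr rfl fun y _ => ?_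
  simp

theorem sum_marg (μ : (Fin n → Fin q) → ℝ) (i : Fin n) : ∑ r, marg μ i r = ∑ y, μ y := by
  simpa using (sum_mul_apply_eq_sum_marg μ i fun _ => 1).symm

theorem marg_nonneg {μ : (Fin n → Fin q) → ℝ} (hμ : ∀ y, 0 ≤ μ y) (i : Fin n) (r : Fin q) :
    0 ≤ marg μ i r :=
  sum_nonneg fun y _ => mul_nonneg (hμ y) (by split_ifs <;> norm_num)

theorem le_marg {μ : (Fin n → Fin q) → ℝ} (hμ : ∀ y, 0 ≤ μ y) (i : Fin n)
    (y : Fin n → Fin q) : μ y ≤ marg μ i (y i) := by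
  have := single_le_sum (f := fun z : Fin n → Fin q => μ z * (if z i = y i then (1 : ℝ) else 0))
    (fun z _ => mul_nonneg (hμ z) (by split_ifs <;> norm_num)) (mem_univ y)
  simpa [marg] using this

theorem marg_mem_stdSimplex {μ : (Fin n → Fin q) → ℝ} (hμ : μ ∈ stdSimplex ℝ (Fin n → Fin q))
    (i : Fin n) : marg μ i ∈ stdSimplex ℝ (Fin q) :=
  ⟨marg_nonneg hμ.1 i, (sum_marg μ i).trans hμ.2⟩

theorem marg_le_one {μ : (Fin n → Fin q) → ℝ} (hμ : μ ∈ stdSimplex ℝ (Fin n → Fin q))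
    (i : Fin n) (r : Fin q) : marg μ i r ≤ 1 := by
  rw [← (marg_mem_stdSimplex hμ i).2]
  exact single_le_sum (fun s _ => marg_nonneg hμ.1 i s) (mem_univ r)

theorem pairMarg_nonneg {μ : (Fin n → Fin q) → ℝ} (hμ : ∀ y, 0 ≤ μ y) (i j : Fin n)
    (r s : Fin q) : 0 ≤ pairMarg μ i j r s :=
  sum_nonneg fun y _ => mul_nonneg (hμ y) (by split_ifs <;> norm_num)

theorem pairMarg_le {μ : (Fin n → Fin q) → ℝ} (hμ : ∀ y, 0 ≤ μ y) (i j : Fin n)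
    (r s : Fin q) : pairMarg μ i j r s ≤ marg μ j s :=
  sum_le_sum fun y _ => mul_le_mul_of_nonneg_left (by split_ifs <;> norm_num) (hμ y)

theorem sum_pairMarg (μ : (Fin n → Fin q) → ℝ) (i j : Fin n) (r : Fin q) :
    ∑ s, pairMarg μ i j r s = marg μ i r := by
  simp only [pairMarg, marg]
  rw [sum_comm]
  refine sum_congr rfl fun y _ => ?_
  simp

theorem abs_cov_le_one {μ : (Fin n → Fin q) → ℝ} (hμ : μ ∈ stdSimplex ℝ (Fin n → Fin q))
    (i j : Fin n) (r s : Fin q) : |cov μ i j r s| ≤ 1 := by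
  have h1 := pairMarg_nonneg hμ.1 i j r s
  have h2 := (pairMarg_le hμ.1 i j r s).trans (marg_le_one hμ j s)
  have h3 := mul_nonneg (marg_nonneg hμ.1 i r) (marg_nonneg hμ.1 j s)
  have h4 := mul_le_one₀ (marg_le_one hμ i r) (marg_nonneg hμ.1 j s) (marg_le_one hμ j s)
  rw [cov, abs_le]
  constructor <;> linarith

theorem totalVar_le {μ : (Fin n → Fin q) → ℝ} (hμ : μ ∈ stdSimplex ℝ (Fin n → Fin q)) :
    totalVar μ ≤ n := by
  calc totalVar μ ≤ ∑ i : Fin n, ∑ r, marg μ i r :=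
        sum_le_sum fun i _ => sum_le_sum fun r _ => sub_le_self _ (sq_nonneg _)
    _ = n := by simp [(sum_marg μ _).trans hμ.2]

theorem totalVar_nonneg {μ : (Fin n → Fin q) → ℝ} (hμ : μ ∈ stdSimplex ℝ (Fin n → Fin q)) :
    0 ≤ totalVar μ := by
  refine sum_nonneg fun i _ => sum_nonneg fun r _ => ?_
  nlinarith [marg_nonneg hμ.1 i r, marg_le_one hμ i r]

/-! ### Conditioning on the colour of one site -/

theorem marg_mul_condAt {μ : (Fin n → Fin q) → ℝ} (hμ : ∀ y, 0 ≤ μ y) (j : Fin n) (s : Fin q)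
    (y : Fin n → Fin q) :
    marg μ j s * condAt μ j s y = μ y * (if y j = s then (1 : ℝ) else 0) := by
  by_cases h : marg μ j s = 0
  · rw [h, zero_mul]
    split_ifs with hy
    · subst hy
      have := le_marg hμ j y
      linarith [hμ y]
    · simp
  · rw [condAt, mul_div_cancel₀ _ h]

theorem marg_condAt (μ : (Fin n → Fin q) → ℝ) (i j : Fin n) (r s : Fin q) :
    marg (condAt μ j s) i r = pairMarg μ i j r s / marg μ j s := by
  simp only [marg, pairMarg, condAt, sum_div]
  exact sum_congr rfl fun y _ => by ring

theorem condAt_mem_stdSimplex {μ : (Fin n → Fin q) → ℝ} (hμ : ∀ y, 0 ≤ μ y) {j : Fin n}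
    {s : Fin q} (hs : marg μ j s ≠ 0) : condAt μ j s ∈ stdSimplex ℝ (Fin n → Fin q) := by
  refine ⟨fun y => div_nonneg (mul_nonneg (hμ y) (by split_ifs <;> norm_num))
    (marg_nonneg hμ j s), ?_⟩
  simp only [condAt]
  rw [← sum_div]
  exact div_self hs

/-- Chain rule for entropy: the second sum is the entropy of the colour at `j`, at most `log q`. -/
theorem freeEnergy_eq_sum_condAt (H : (Fin n → Fin q) → ℝ) {μ : (Fin n → Fin q) → ℝ}
    (hμ : μ ∈ stdSimplex ℝ (Fin n → Fin q)) (j : Fin n) :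
    freeEnergy H μ = ∑ s, marg μ j s * freeEnergy H (condAt μ j s)
      - ∑ s, marg μ j s * log (marg μ j s) := by
  have key : ∀ s y, (μ y * H y - μ y * log (μ y)) * (if y j = s then (1 : ℝ) else 0)
      = marg μ j s * (condAt μ j s y * H y - condAt μ j s y * log (condAt μ j s y))
        - (μ y * (if y j = s then (1 : ℝ) else 0)) * log (marg μ j s) := by
    intro s y
    have h1 := marg_mul_condAt hμ.1 j s y
    by_cases h0 : μ y * (if y j = s then (1 : ℝ) else 0) = 0
    · have h2 : condAt μ j s y = 0 := by rw [condAt, h0, zero_div]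
      rw [h2, h0]
      linear_combination (H y - log (μ y)) * h0
    · have hy : y j = s := by
        by_contra hy
        simp [hy] at h0
      have hne := h1 ▸ h0
      have hm := left_ne_zero_of_mul hne
      have hc := right_ne_zero_of_mul hne
      simp only [hy, if_true, mul_one] at h1 ⊢
      rw [← h1, log_mul hm hc]
      ring
  calc freeEnergy H μ
      = ∑ y, ∑ s, (μ y * H y - μ y * log (μ y)) * (if y j = s then (1 : ℝ) else 0) := by
        simp [freeEnergy]
    _ = ∑ s, ∑ y, (marg μ j s * (condAt μ j s y * H y - condAt μ j s y * log (condAt μ j s y))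
        - (μ y * (if y j = s then (1 : ℝ) else 0)) * log (marg μ j s)) := by
        rw [sum_comm]
        simp only [key]
    _ = _ := by
        simp only [sum_sub_distrib, ← mul_sum, ← sum_mul, freeEnergy]
        rfl

theorem sum_negMulLog_le_log (hq : 0 < q) {p : Fin q → ℝ} (hp : p ∈ stdSimplex ℝ (Fin q)) :
    -∑ s, p s * log (p s) ≤ log q := by
  have hq' : (0 : ℝ) < q := by exact_mod_cast hq
  have := sum_mul_log_sub_le p (fun _ => (q : ℝ)⁻¹) hp.1 (fun _ => by positivity)
    (fun _ _ => by positivity)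
  rw [← sum_mul, hp.2] at this
  simp [hq'.ne'] at this
  linarith

theorem freeEnergy_le_condAt (hq : 0 < q) (H : (Fin n → Fin q) → ℝ) {μ : (Fin n → Fin q) → ℝ}
    (hμ : μ ∈ stdSimplex ℝ (Fin n → Fin q)) (j : Fin n) :
    freeEnergy H μ ≤ log q + ∑ s, marg μ j s * freeEnergy H (condAt μ j s) := by
  have h1 := freeEnergy_eq_sum_condAt H hμ j
  have h2 := sum_negMulLog_le_log hq (marg_mem_stdSimplex hμ j)
  linarith

/-- Conditioning on the colour of site `j` lowers the expected total variance by at least the sum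
of the squared covariances with site `j`. -/
theorem sum_totalVar_condAt_le {μ : (Fin n → Fin q) → ℝ}
    (hμ : μ ∈ stdSimplex ℝ (Fin n → Fin q)) (j : Fin n) :
    ∑ s, marg μ j s * totalVar (condAt μ j s)
      ≤ totalVar μ - ∑ i, ∑ r, ∑ s, cov μ i j r s ^ 2 := by
  have h1 : ∑ s, marg μ j s * totalVar (condAt μ j s)
      = ∑ i, ∑ r, ∑ s, marg μ j s * (marg (condAt μ j s) i r - marg (condAt μ j s) i r ^ 2) := by
    simp only [totalVar, mul_sum]
    rw [sum_comm]
    exact sum_congr rfl fun i _ => sum_comm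
  rw [h1, totalVar, ← sum_sub_distrib]
  refine sum_le_sum fun i _ => ?_
  rw [← sum_sub_distrib]
  refine sum_le_sum fun r _ => ?_
  -- Law of total variance: the conditional means have variance `∑ s, (P - m p)² / p`, and `p ≤ 1`
  -- makes this at least the sum of squared covariances.
  have h2 : ∀ s, marg μ j s * (marg (condAt μ j s) i r - marg (condAt μ j s) i r ^ 2)
      ≤ pairMarg μ i j r s - 2 * marg μ i r * pairMarg μ i j r s
        + marg μ i r ^ 2 * marg μ j s - cov μ i j r s ^ 2 := by
    intro s
    rw [marg_condAt, cov]
    set m := marg μ i r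
    set P := pairMarg μ i j r s
    have hp0 := marg_nonneg hμ.1 j s
    have hp1 := marg_le_one hμ j s
    have hP0 : 0 ≤ P := pairMarg_nonneg hμ.1 i j r s
    have hP1 : P ≤ marg μ j s := pairMarg_le hμ.1 i j r s
    set p := marg μ j s
    rcases hp0.eq_or_lt with h | h
    · have : P = 0 := by linarith
      simp [this, ← h]
    · have h3 : p * (P / p - (P / p) ^ 2) = P - P ^ 2 / p := by field_simp
      have h4 : (P - m * p) ^ 2 ≤ (P - m * p) ^ 2 / p := by
        rw [le_div_iff₀ h]
        exact mul_le_of_le_one_right (sq_nonneg _) hp1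
      have h5 : (P - m * p) ^ 2 / p = P ^ 2 / p - 2 * m * P + m ^ 2 * p := by
        field_simp
        ring
      rw [h3]
      linarith
  refine (sum_le_sum fun s _ => h2 s).trans (le_of_eq ?_)
  rw [sum_sub_distrib, sum_add_distrib, sum_sub_distrib, ← mul_sum, ← mul_sum, sum_pairMarg,
    (sum_marg μ j).trans hμ.2]
  ring

theorem exists_covSq_le_card_mul (μ : (Fin n → Fin q) → ℝ) (hn : 0 < n) :
    ∃ j, covSq μ ≤ n * ∑ i, ∑ r, ∑ s, cov μ i j r s ^ 2 := by
  have : Nonempty (Fin n) := ⟨⟨0, hn⟩⟩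
  obtain ⟨j, -, hj⟩ := exists_max_image (univ : Finset (Fin n))
    (fun j => ∑ i, ∑ r, ∑ s, cov μ i j r s ^ 2) univ_nonempty
  refine ⟨j, ?_⟩
  rw [covSq, sum_comm]
  refine (sum_le_sum fun k hk => hj k hk).trans (le_of_eq ?_)
  simp

/-- Ensures that a site with nonzero covariances is not deterministic, so that conditioning on it
shrinks the support. -/
theorem cov_eq_zero_of_marg_eq_one {μ : (Fin n → Fin q) → ℝ}
    (hμ : μ ∈ stdSimplex ℝ (Fin n → Fin q)) {j : Fin n} {t : Fin q} (ht : marg μ j t = 1)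
    (i : Fin n) (r s : Fin q) : cov μ i j r s = 0 := by
  have h0 : ∀ s, s ≠ t → marg μ j s = 0 := by
    intro s hs
    have h1 := (marg_mem_stdSimplex hμ j).2
    rw [← add_sum_erase _ _ (mem_univ t), ht] at h1
    exact (sum_eq_zero_iff_of_nonneg fun k _ => marg_nonneg hμ.1 j k).1 (by linarith) s
      (mem_erase.2 ⟨hs, mem_univ s⟩)
  have h2 : ∀ s, s ≠ t → pairMarg μ i j r s = 0 := fun s hs =>
    le_antisymm ((pairMarg_le hμ.1 i j r s).trans (h0 s hs).le) (pairMarg_nonneg hμ.1 i j r s)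
  by_cases hs : s = t
  · subst hs
    have h3 := sum_pairMarg μ i j r
    rw [← add_sum_erase _ _ (mem_univ s), sum_eq_zero fun k hk => h2 k (ne_of_mem_erase hk)] at h3
    rw [cov, ht]
    linarith
  · rw [cov, h2 s hs, h0 s hs]
    ring

/-- Conditioning on a non-deterministic site strictly shrinks the support. -/
theorem card_support_condAt_lt {μ : (Fin n → Fin q) → ℝ}
    (hμ : μ ∈ stdSimplex ℝ (Fin n → Fin q)) {j : Fin n} {s : Fin q} (hs : marg μ j s ≠ 1) :
    #{y | condAt μ j s y ≠ 0} < #{y | μ y ≠ 0} := by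
  refine card_lt_card ?_
  rw [Finset.ssubset_iff_of_subset]
  · by_contra! hcon
    apply hs
    rw [← hμ.2, marg]
    refine sum_congr rfl fun y _ => ?_
    by_cases hy : μ y = 0
    · simp [hy]
    · have h1 := hcon y (by simpa using hy)
      have h2 : y j = s := by
        by_contra h
        simp [condAt, h] at h1
      simp [h2]
  · intro y hy
    simp only [mem_filter, mem_univ, true_and] at hy ⊢
    intro h
    exact hy (by simp [condAt, h])

/-- If `freeEnergy H` is at most `S` on weights with small covariances, then on every weight it
exceeds `S` by at most a multiple of the total variance. -/
theorem freeEnergy_le_add_totalVar (hq : 0 < q) (hn : 0 < n) (H : (Fin n → Fin q) → ℝ)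
    {κ S : ℝ} (hκ : 0 < κ)
    (hS : ∀ μ ∈ stdSimplex ℝ (Fin n → Fin q), covSq μ ≤ κ * n → freeEnergy H μ ≤ S)
    {μ : (Fin n → Fin q) → ℝ} (hμ : μ ∈ stdSimplex ℝ (Fin n → Fin q)) :
    freeEnergy H μ ≤ S + log q / κ * totalVar μ := by
  have hq' : (1 : ℝ) ≤ q := by exact_mod_cast hq
  have hn' : (0 : ℝ) < n := by exact_mod_cast hn
  have hc : 0 ≤ log q / κ := div_nonneg (log_nonneg hq') hκ.le
  -- The support size only serves termination; the bound itself is driven by `totalVar`.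
  induction hN : #{y | μ y ≠ 0} using Nat.strong_induction_on generalizing μ with
  | _ N ih =>
  subst hN
  rcases le_or_gt (covSq μ) (κ * n) with hK | hK
  · exact (hS μ hμ hK).trans (le_add_of_nonneg_right (mul_nonneg hc (totalVar_nonneg hμ)))
  obtain ⟨j, hj⟩ := exists_covSq_le_card_mul μ hn
  have hdrop : κ < ∑ i, ∑ r, ∑ s, cov μ i j r s ^ 2 := by
    by_contra! hcon
    have := mul_le_mul_of_nonneg_left hcon hn'.le
    linarith
  have hne : ∀ s, marg μ j s ≠ 1 := by
    intro s hs
    have : ∑ i, ∑ r, ∑ s, cov μ i j r s ^ 2 = 0 := by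
      simp [cov_eq_zero_of_marg_eq_one hμ hs]
    linarith
  have hstep : ∑ s, marg μ j s * freeEnergy H (condAt μ j s)
      ≤ ∑ s, marg μ j s * (S + log q / κ * totalVar (condAt μ j s)) := by
    refine sum_le_sum fun s _ => ?_
    by_cases h0 : marg μ j s = 0
    · simp [h0]
    · exact mul_le_mul_of_nonneg_left (ih _ (card_support_condAt_lt hμ (hne s))
        (condAt_mem_stdSimplex hμ.1 h0) rfl) (marg_nonneg hμ.1 j s)
  have hsplit : ∑ s, marg μ j s * (S + log q / κ * totalVar (condAt μ j s))
      = S + log q / κ * ∑ s, marg μ j s * totalVar (condAt μ j s) := by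
    simp only [mul_add, sum_add_distrib, ← sum_mul, (sum_marg μ j).trans hμ.2, one_mul, mul_sum]
    congr 1
    exact sum_congr rfl fun s _ => by ring
  have h1 := freeEnergy_le_condAt hq H hμ j
  have h2 := mul_le_mul_of_nonneg_left
    ((sum_totalVar_condAt_le hμ j).trans (sub_le_sub_left hdrop.le _)) hc
  -- The drop of `κ` in variance pays exactly for the `log q` of entropy.
  have h3 : log q / κ * (totalVar μ - κ) = log q / κ * totalVar μ - log q := by
    field_simp
  linarith

/-! ### Product weights -/

theorem sum_prodWeight (p : Fin n → Fin q → ℝ) : ∑ y, prodWeight p y = ∏ i, ∑ r, p i r := by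
  simp only [prodWeight]
  rw [prod_univ_sum, Fintype.piFinset_univ]

theorem prodWeight_mem_stdSimplex {p : Fin n → Fin q → ℝ} (hp : ∀ i, p i ∈ stdSimplex ℝ (Fin q)) :
    prodWeight p ∈ stdSimplex ℝ (Fin n → Fin q) := by
  refine ⟨fun y => prod_nonneg fun i _ => (hp i).1 _, ?_⟩
  rw [sum_prodWeight]
  exact prod_eq_one fun i _ => (hp i).2

theorem marg_prodWeight {p : Fin n → Fin q → ℝ} (hp : ∀ i, p i ∈ stdSimplex ℝ (Fin q))
    (i : Fin n) (r : Fin q) : marg (prodWeight p) i r = p i r := by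
  -- The indicator is absorbed into the factor at site `i`, so the sum over configurations
  -- factorizes.
  have h1 : marg (prodWeight p) i r = ∑ y, prodWeight
      (fun k s => p k s * if k = i then (if s = r then (1 : ℝ) else 0) else 1) y := by
    refine sum_congr rfl fun y _ => ?_
    simp only [prodWeight, prod_mul_distrib]
    simp
  rw [h1, sum_prodWeight, Finset.prod_eq_single i]
  · simp
  · intro k _ hk
    simpa [hk] using (hp k).2
  · simp

theorem pairMarg_prodWeight {p : Fin n → Fin q → ℝ} (hp : ∀ i, p i ∈ stdSimplex ℝ (Fin q))
    {i j : Fin n} (hij : i ≠ j) (r s : Fin q) :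
    pairMarg (prodWeight p) i j r s = p i r * p j s := by
  have h1 : pairMarg (prodWeight p) i j r s = ∑ y, prodWeight
      (fun k t => p k t * ((if k = i then (if t = r then (1 : ℝ) else 0) else 1) *
        (if k = j then (if t = s then (1 : ℝ) else 0) else 1))) y := by
    refine sum_congr rfl fun y _ => ?_
    simp only [prodWeight, prod_mul_distrib]
    simp
  rw [h1, sum_prodWeight, Fintype.prod_eq_mul i j hij]
  · simp [hij, hij.symm]
  · rintro k ⟨hki, hkj⟩
    simpa [hki, hkj] using (hp k).2

/-- Distinct sites are uncorrelated, so only the `n` diagonal pairs contribute, each at most `q²`.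
-/
theorem covSq_prodWeight_le {p : Fin n → Fin q → ℝ} (hp : ∀ i, p i ∈ stdSimplex ℝ (Fin q)) :
    covSq (prodWeight p) ≤ q ^ 2 * n := by
  have h1 : ∀ i j, ∑ r, ∑ s, cov (prodWeight p) i j r s ^ 2
      ≤ if i = j then (q : ℝ) ^ 2 else 0 := by
    intro i j
    split_ifs with hij
    · calc ∑ r, ∑ s, cov (prodWeight p) i j r s ^ 2 ≤ ∑ r : Fin q, ∑ s : Fin q, (1 : ℝ) := by
            refine sum_le_sum fun r _ => sum_le_sum fun s _ => ?_
            exact (sq_le_one_iff_abs_le_one _).2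
              (abs_cov_le_one (prodWeight_mem_stdSimplex hp) i j r s)
        _ = (q : ℝ) ^ 2 := by simp [sq]
    · simp [cov, pairMarg_prodWeight hp hij, marg_prodWeight hp]
  refine (sum_le_sum fun i _ => sum_le_sum fun j _ => h1 i j).trans (le_of_eq ?_)
  simp [mul_comm]

theorem sum_mul_log_prodWeight (μ : (Fin n → Fin q) → ℝ) (p : Fin n → Fin q → ℝ)
    (hp : ∀ y, μ y ≠ 0 → ∀ i, p i (y i) ≠ 0) :
    ∑ y, μ y * log (prodWeight p y) = ∑ i, ∑ r, marg μ i r * log (p i r) := by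
  simp only [← sum_mul_apply_eq_sum_marg]
  rw [sum_comm]
  refine sum_congr rfl fun y _ => ?_
  rw [← mul_sum]
  by_cases h : μ y = 0
  · simp [h]
  · rw [prodWeight, log_prod fun i _ => hp y h i]

/-- Subadditivity of the Shannon entropy. -/
theorem sum_marg_mul_log_le {μ : (Fin n → Fin q) → ℝ} (hμ : μ ∈ stdSimplex ℝ (Fin n → Fin q)) :
    ∑ i, ∑ r, marg μ i r * log (marg μ i r) ≤ ∑ y, μ y * log (μ y) := by
  have hac : ∀ y, μ y ≠ 0 → ∀ i, marg μ i (y i) ≠ 0 := fun y hy i =>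
    ((lt_of_le_of_ne (hμ.1 y) (Ne.symm hy)).trans_le (le_marg hμ.1 i y)).ne'
  have hQ := prodWeight_mem_stdSimplex (marg_mem_stdSimplex hμ)
  have := sum_mul_log_sub_le μ (prodWeight (marg μ)) hμ.1 hQ.1
    fun y hy => prod_ne_zero_iff.2 fun i _ => hac y hy i
  rw [sum_mul_log_prodWeight _ _ hac, hμ.2, hQ.2] at this
  linarith

/-! ### The Potts Hamiltonian -/

theorem sum_mul_hamiltonian (A : Matrix (Fin n) (Fin n) ℝ) (J : Matrix (Fin q) (Fin q) ℝ)
    (h : Fin q → ℝ) (μ : (Fin n → Fin q) → ℝ) :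
    ∑ y, μ y * hamiltonian A J h y
      = (1 / 2 : ℝ) * (∑ i, ∑ j, A i j * ∑ r, ∑ s, J r s * pairMarg μ i j r s)
        + ∑ i, ∑ r, h r * marg μ i r := by
  simp only [hamiltonian, pairMarg, marg, mul_add, sum_add_distrib, mul_sum]
  congr 1
  · rw [sum_comm]
    refine sum_congr rfl fun i _ => ?_
    rw [sum_comm]
    refine sum_congr rfl fun j _ => ?_
    rw [sum_comm]
    refine sum_congr rfl fun r _ => ?_
    rw [sum_comm]
    refine sum_congr rfl fun s _ => sum_congr rfl fun y _ => ?_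
    ring
  · rw [sum_comm]
    refine sum_congr rfl fun i _ => ?_
    rw [sum_comm]
    refine sum_congr rfl fun r _ => sum_congr rfl fun y _ => ?_
    ring

/-- The contribution of the covariances to the expected energy. -/
def covEnergy (A : Matrix (Fin n) (Fin n) ℝ) (J : Matrix (Fin q) (Fin q) ℝ)
    (μ : (Fin n → Fin q) → ℝ) : ℝ :=
  (1 / 2 : ℝ) * ∑ i, ∑ j, A i j * ∑ r, ∑ s, J r s * cov μ i j r s

/-- The last bracket is nonpositive by `sum_marg_mul_log_le`, and zero for product weights. -/
theorem freeEnergy_hamiltonian_eq (A : Matrix (Fin n) (Fin n) ℝ) (J : Matrix (Fin q) (Fin q) ℝ)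
    (h : Fin q → ℝ) (μ : (Fin n → Fin q) → ℝ) (p : Fin n → stdSimplex ℝ (Fin q))
    (hp : ∀ i r, (p i).1 r = marg μ i r) :
    freeEnergy (hamiltonian A J h) μ = meanFieldFunctional A J h p + covEnergy A J μ
      + (∑ i, ∑ r, marg μ i r * log (marg μ i r) - ∑ y, μ y * log (μ y)) := by
  have h1 : ∑ i, ∑ j, A i j * ∑ r, ∑ s, J r s * cov μ i j r s
      = ∑ i, ∑ j, A i j * ∑ r, ∑ s, J r s * pairMarg μ i j r s
        - ∑ i, ∑ j, A i j * ∑ r, ∑ s, marg μ i r * marg μ j s * J r s := by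
    simp only [← sum_sub_distrib, ← mul_sub, cov]
    refine sum_congr rfl fun i _ => sum_congr rfl fun j _ => ?_
    congr 1
    refine sum_congr rfl fun r _ => sum_congr rfl fun s _ => ?_
    ring
  simp only [freeEnergy, sum_sub_distrib, sum_mul_hamiltonian, meanFieldFunctional, hp, covEnergy,
    h1]
  ring

/-- Young's inequality on each product `(A i j * J r s) * cov μ i j r s`; the weight `t` is left
free to balance the two terms. -/
theorem abs_covEnergy_le (A : Matrix (Fin n) (Fin n) ℝ) (J : Matrix (Fin q) (Fin q) ℝ)
    (μ : (Fin n → Fin q) → ℝ) {t : ℝ} (ht : 0 < t) :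
    |covEnergy A J μ| ≤
      (1 / 4 : ℝ) * (t * ((∑ i, ∑ j, A i j ^ 2) * ∑ r, ∑ s, J r s ^ 2) + covSq μ / t) := by
  have h1 : ∀ x y : ℝ, |x * y| ≤ (1 / 2 : ℝ) * (t * x ^ 2 + y ^ 2 / t) := by
    intro x y
    have h2 : t * x ^ 2 + y ^ 2 / t - 2 * |x * y| = (t * |x| - |y|) ^ 2 / t := by
      rw [abs_mul, ← sq_abs x, ← sq_abs y]
      field_simp
      ring
    have h3 : 0 ≤ (t * |x| - |y|) ^ 2 / t := by positivity
    linarith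
  have h4 : ∑ i, ∑ j, ∑ r, ∑ s, (A i j * J r s) ^ 2
      = (∑ i, ∑ j, A i j ^ 2) * ∑ r, ∑ s, J r s ^ 2 := by
    simp only [sum_mul]
    refine sum_congr rfl fun i _ => sum_congr rfl fun j _ => ?_
    simp only [mul_sum, mul_pow]
  have h5 : |∑ i, ∑ j, A i j * ∑ r, ∑ s, J r s * cov μ i j r s|
      ≤ ∑ i, ∑ j, ∑ r, ∑ s,
        (1 / 2 : ℝ) * (t * (A i j * J r s) ^ 2 + cov μ i j r s ^ 2 / t) := by
    simp only [mul_sum, ← mul_assoc (A _ _)]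
    refine (abs_sum_le_sum_abs _ _).trans (sum_le_sum fun i _ => ?_)
    refine (abs_sum_le_sum_abs _ _).trans (sum_le_sum fun j _ => ?_)
    refine (abs_sum_le_sum_abs _ _).trans (sum_le_sum fun r _ => ?_)
    exact (abs_sum_le_sum_abs _ _).trans (sum_le_sum fun s _ => h1 _ _)
  simp only [← mul_sum, sum_add_distrib, ← sum_div, h4] at h5
  rw [covEnergy, abs_mul, covSq, abs_of_pos (by norm_num : (0 : ℝ) < 1 / 2)]
  linarith

/-! ### The Gibbs variational principle. -/

theorem partitionFunction_pos (hq : 0 < q) (A : Matrix (Fin n) (Fin n) ℝ)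
    (J : Matrix (Fin q) (Fin q) ℝ) (h : Fin q → ℝ) : 0 < partitionFunction A J h :=
  have : Nonempty (Fin n → Fin q) := ⟨fun _ => ⟨0, hq⟩⟩
  sum_pos (fun _ _ => exp_pos _) univ_nonempty

/-- The Gibbs measure of the generalized Potts model. -/
def gibbs (A : Matrix (Fin n) (Fin n) ℝ) (J : Matrix (Fin q) (Fin q) ℝ)
    (h : Fin q → ℝ) (y : Fin n → Fin q) : ℝ :=
  exp (hamiltonian A J h y) / partitionFunction A J h

theorem gibbs_pos (hq : 0 < q) (A : Matrix (Fin n) (Fin n) ℝ) (J : Matrix (Fin q) (Fin q) ℝ)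
    (h : Fin q → ℝ) (y : Fin n → Fin q) : 0 < gibbs A J h y :=
  div_pos (exp_pos _) (partitionFunction_pos hq A J h)

theorem gibbs_mem_stdSimplex (hq : 0 < q) (A : Matrix (Fin n) (Fin n) ℝ)
    (J : Matrix (Fin q) (Fin q) ℝ) (h : Fin q → ℝ) :
    gibbs A J h ∈ stdSimplex ℝ (Fin n → Fin q) := by
  refine ⟨fun y => (gibbs_pos hq A J h y).le, ?_⟩
  simp only [gibbs]
  rw [← sum_div]
  exact div_self (partitionFunction_pos hq A J h).ne'

theorem log_gibbs (hq : 0 < q) (A : Matrix (Fin n) (Fin n) ℝ)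
    (J : Matrix (Fin q) (Fin q) ℝ) (h : Fin q → ℝ) (y : Fin n → Fin q) :
    log (gibbs A J h y) = hamiltonian A J h y - logPartition A J h := by
  rw [gibbs, log_div (exp_pos _).ne' (partitionFunction_pos hq A J h).ne', log_exp, logPartition]

theorem freeEnergy_gibbs (hq : 0 < q) (A : Matrix (Fin n) (Fin n) ℝ)
    (J : Matrix (Fin q) (Fin q) ℝ) (h : Fin q → ℝ) :
    freeEnergy (hamiltonian A J h) (gibbs A J h) = logPartition A J h := by
  simp only [freeEnergy, log_gibbs hq, mul_sub, sub_sub_cancel]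
  rw [← sum_mul, (gibbs_mem_stdSimplex hq A J h).2, one_mul]

theorem freeEnergy_le_logPartition (hq : 0 < q) (A : Matrix (Fin n) (Fin n) ℝ)
    (J : Matrix (Fin q) (Fin q) ℝ) (h : Fin q → ℝ) {μ : (Fin n → Fin q) → ℝ}
    (hμ : μ ∈ stdSimplex ℝ (Fin n → Fin q)) :
    freeEnergy (hamiltonian A J h) μ ≤ logPartition A J h := by
  have hG := gibbs_mem_stdSimplex (n := n) hq A J h
  have := sum_mul_log_sub_le μ (gibbs A J h) hμ.1 hG.1 fun y _ => (gibbs_pos hq A J h y).ne'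
  simp only [log_gibbs hq, mul_sub, sum_sub_distrib, ← sum_mul, hμ.2, hG.2] at this
  rw [freeEnergy, sum_sub_distrib]
  linarith

/-! ### Two-sided comparison at fixed `n`. -/

/-- The product weight is a trial weight in the variational principle; the error comes from the
diagonal of `A`, which may be nonzero. -/
theorem meanFieldFunctional_le (hq : 0 < q) (A : Matrix (Fin n) (Fin n) ℝ)
    (J : Matrix (Fin q) (Fin q) ℝ) (h : Fin q → ℝ) (p : Fin n → stdSimplex ℝ (Fin q))
    {t : ℝ} (ht : 0 < t) :
    meanFieldFunctional A J h p ≤ logPartition A J h + (1 / 4 : ℝ) *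
      (t * ((∑ i, ∑ j, A i j ^ 2) * ∑ r, ∑ s, J r s ^ 2) + q ^ 2 * n / t) := by
  set Q := prodWeight fun i => (p i).1 with hQdef
  have hp : ∀ i, (p i).1 ∈ stdSimplex ℝ (Fin q) := fun i => (p i).2
  have hQ : Q ∈ stdSimplex ℝ (Fin n → Fin q) := prodWeight_mem_stdSimplex hp
  have hm : ∀ i r, (p i).1 r = marg Q i r := fun i r => (marg_prodWeight hp i r).symm
  have h1 := freeEnergy_hamiltonian_eq A J h Q p hm
  have h2 : ∑ y, Q y * log (Q y) = ∑ i, ∑ r, marg Q i r * log (marg Q i r) := by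
    have := sum_mul_log_prodWeight Q (fun i => (p i).1)
      fun y hy i => prod_ne_zero_iff.1 hy i (mem_univ i)
    simpa only [← hQdef, hm] using this
  have h3 := freeEnergy_le_logPartition hq A J h hQ
  have h4 := abs_covEnergy_le A J Q ht
  have h5 : covSq Q / t ≤ q ^ 2 * n / t := by
    gcongr
    exact covSq_prodWeight_le hp
  have h6 := neg_abs_le (covEnergy A J Q)
  linarith

theorem logPartition_le (hq : 0 < q) (hn : 0 < n) (A : Matrix (Fin n) (Fin n) ℝ)
    (J : Matrix (Fin q) (Fin q) ℝ) (h : Fin q → ℝ) {S : ℝ}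
    (hS : ∀ p, meanFieldFunctional A J h p ≤ S) {t κ : ℝ} (ht : 0 < t) (hκ : 0 < κ) :
    logPartition A J h ≤ S + (1 / 4 : ℝ) *
      (t * ((∑ i, ∑ j, A i j ^ 2) * ∑ r, ∑ s, J r s ^ 2) + κ * n / t) + log q / κ * n := by
  rw [← freeEnergy_gibbs hq]
  have hG := gibbs_mem_stdSimplex (n := n) hq A J h
  have hq' : (1 : ℝ) ≤ q := by exact_mod_cast hq
  refine (freeEnergy_le_add_totalVar hq hn (hamiltonian A J h) hκ (fun μ hμ hK => ?_) hG).trans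
    (add_le_add_right (mul_le_mul_of_nonneg_left (totalVar_le hG)
      (div_nonneg (log_nonneg hq') hκ.le)) _)
  have h1 := freeEnergy_hamiltonian_eq A J h μ (fun i => ⟨marg μ i, marg_mem_stdSimplex hμ i⟩)
    fun _ _ => rfl
  have h2 := sum_marg_mul_log_le hμ
  have h3 := abs_covEnergy_le A J μ ht
  have h4 : covSq μ / t ≤ κ * n / t := by gcongr
  have h5 := le_abs_self (covEnergy A J μ)
  have h6 := hS fun i => ⟨marg μ i, marg_mem_stdSimplex hμ i⟩
  linarith

/-- A quantitative form of the mean-field approximation. -/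
theorem abs_logPartition_sub_iSup_le (hq : 0 < q) (hn : 0 < n) (A : Matrix (Fin n) (Fin n) ℝ)
    (J : Matrix (Fin q) (Fin q) ℝ) (h : Fin q → ℝ) {t κ : ℝ} (ht : 0 < t) (hκ : (q : ℝ) ^ 2 ≤ κ) :
    |logPartition A J h - ⨆ p : Fin n → stdSimplex ℝ (Fin q), meanFieldFunctional A J h p|
      ≤ (1 / 4 : ℝ) * (t * ((∑ i, ∑ j, A i j ^ 2) * ∑ r, ∑ s, J r s ^ 2) + κ * n / t)
        + log q / κ * n := by
  have hq' : (1 : ℝ) ≤ q := by exact_mod_cast hq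
  have hκ0 : 0 < κ := lt_of_lt_of_le (by positivity) hκ
  have : Nonempty (Fin n → stdSimplex ℝ (Fin q)) :=
    ⟨fun _ => ⟨_, single_mem_stdSimplex ℝ (⟨0, hq⟩ : Fin q)⟩⟩
  have hup := fun p => meanFieldFunctional_le hq A J h p ht
  have hbdd : BddAbove (Set.range (meanFieldFunctional A J h)) :=
    ⟨_, Set.forall_mem_range.2 hup⟩
  have h1 := ciSup_le hup
  have h2 := logPartition_le hq hn A J h (fun p => le_ciSup hbdd p) ht hκ0
  -- Here `q² ≤ κ` lets one error term serve both directions.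
  have h3 : (q : ℝ) ^ 2 * n / t ≤ κ * n / t := by gcongr
  have h4 : 0 ≤ log q / κ * n :=
    mul_nonneg (div_nonneg (log_nonneg hq') hκ0.le) (Nat.cast_nonneg n)
  rw [abs_le]
  constructor <;> linarith

theorem trace_sq_eq_sum_sq {A : Matrix (Fin n) (Fin n) ℝ} (hA : A.IsSymm) :
    (A ^ 2).trace = ∑ i, ∑ j, A i j ^ 2 := by
  rw [sq, Matrix.trace]
  refine sum_congr rfl fun i _ => ?_
  rw [Matrix.diag_apply, Matrix.mul_apply]
  refine sum_congr rfl fun j _ => ?_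
  rw [hA.apply i j, sq]

end

end MeanFieldPotts

/-! ### Choice of parameters and the limit. -/

theorem mainTheorem1 (q : ℕ) (hq : 2 ≤ q)
    (J : Matrix (Fin q) (Fin q) ℝ) (hJ : J.IsSymm) (h : Fin q → ℝ)
    (A : (n : ℕ) → Matrix (Fin n) (Fin n) ℝ)
    (hA : MeanFieldPotts.MeanFieldAssumption A) :
    Tendsto (fun n : ℕ => (1 / (n : ℝ)) *
        (MeanFieldPotts.logPartition (A n) J h
          - ⨆ p : Fin n → stdSimplex ℝ (Fin q), MeanFieldPotts.meanFieldFunctional (A n) J h p))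
      atTop (𝓝 0) := by
  have hq0 : 0 < q := by omega
  rw [Metric.tendsto_atTop']
  intro ε hε
  set B : ℝ := ∑ r, ∑ s, J r s ^ 2 with hB
  have hB0 : 0 ≤ B := Finset.sum_nonneg fun r _ => Finset.sum_nonneg fun s _ => sq_nonneg _
  have hL : 0 ≤ Real.log q := Real.log_natCast_nonneg q
  -- The second summand forces `log q / κ ≤ ε / 4`.
  set κ : ℝ := (q : ℝ) ^ 2 + 4 * Real.log q / ε with hκ
  have hκq : (q : ℝ) ^ 2 ≤ κ := le_add_of_nonneg_right (by positivity)
  have hκ0 : 0 < κ := lt_of_lt_of_le (by positivity) hκq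
  -- Chosen so that `κ n / t = ε n`.
  set t : ℝ := κ / ε with ht
  have ht0 : 0 < t := by positivity
  -- The `+ 1` covers `B = 0`; this tolerance gives `t * (a * B) ≤ ε n`.
  have hη : 0 < ε / (t * B + 1) := by positivity
  have hev := (hA.trace_isLittleO.def hη).and (eventually_gt_atTop 0)
  obtain ⟨N, hN⟩ := eventually_atTop.1 hev
  refine ⟨N, fun n hn => ?_⟩
  obtain ⟨h1, hn0⟩ := hN n hn.le
  have hn' : (0 : ℝ) < n := by exact_mod_cast hn0
  rw [MeanFieldPotts.trace_sq_eq_sum_sq (hA.symm n), Real.norm_eq_abs, Real.norm_natCast] at h1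
  have h2 := MeanFieldPotts.abs_logPartition_sub_iSup_le hq0 hn0 (A n) J h ht0 hκq
  rw [← hB] at h2
  set a : ℝ := ∑ i, ∑ j, A n i j ^ 2
  have h3 : t * (a * B) ≤ ε * n := by
    calc t * (a * B) = t * B * a := by ring
      _ ≤ t * B * (ε / (t * B + 1) * n) := by
          gcongr
          exact (le_abs_self a).trans h1
      _ = t * B / (t * B + 1) * (ε * n) := by ring
      _ ≤ 1 * (ε * n) := by
          gcongr
          rw [div_le_one (by positivity)]
          linarith
      _ = ε * n := one_mul _
  have h4 : κ * n / t = ε * n := by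
    rw [ht]
    field_simp
  have h5 : Real.log q / κ * n ≤ ε / 4 * n := by
    refine mul_le_mul_of_nonneg_right ?_ hn'.le
    rw [div_le_iff₀ hκ0]
    have : ε / 4 * κ = ε / 4 * (q : ℝ) ^ 2 + Real.log q := by
      rw [hκ]
      field_simp
    have : 0 ≤ ε / 4 * (q : ℝ) ^ 2 := by positivity
    linarith
  rw [Real.dist_eq, sub_zero, abs_mul, abs_of_pos (by positivity : 0 < 1 / (n : ℝ)), one_div,
    inv_mul_lt_iff₀ hn']
  -- The three errors add up to at most `(3/4) ε n`, strictly below `ε n`.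
  have : 0 < n * ε := by positivity
  linarith
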